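/- Fix an infinite set of atoms and consider formulas in the signature $\wedge,\vee,\top,\bot,\neg$ (with $\top,\bot$ constants). A logic is a reflexive, monotone, structural (closed under substitutions) set of rules $\Gamma\vdash\varphi$ that is closed under cut. A matrix is a pair $\langle A,F\rangle$ of an algebra $A$ of this signature and a set $F\subseteq A$ of designated values; $\Gamma\vdash\varphi$ is valid in it if $v[\Gamma]\subseteq F$ implies $v(\varphi)\in F$ for every valuation $v$. A logic $L$ is complete with respect to a class $K$ of matrices if its rules are exactly the rules valid in every matrix of $K$, and a matrix is a model of $L$ if every rule of $L$ is valid in it. Let $DM_4$ be the four-element De Morgan algebra, the diamond with elements $\top$, $\bot$, $\mathsf b$, $\mathsf n$ whose negation exchanges $\top$ and $\bot$ and fixes $\mathsf b$ and $\mathsf n$. Belnap–Dunn logic $BD$ is the logic of $\langle DM_4,\{\top,\mathsf b\}\rangle$ and the Exactly True Logic $ETL$ is the logic of $\langle DM_4,\{\top\}\rangle$. The logic $ECQ_n$ (respectively $ETL_n$) is the least logic extending $BD$ (respectively $ETL$) which validates the explosive rule $(p_1\wedge\neg p_1)\vee\dots\vee(p_n\wedge\neg p_n)\vdash\emptyset$,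 i.e. the rule with these premises and conclusion $q$, where $p_1,\dots,p_n,q$ are distinct atoms. A graph is a finite set $X$ with a symmetric binary relation $R$ (loops are allowed), and a homomorphism is a map preserving the relation. A graph is $n$-colorable if it has a homomorphism to $K_n=\langle\{1,\dots,n\},\neq\rangle$. For a graph $G=\langle X,R\rangle$ order the disjoint union $X\sqcup\partial X$ of two copies of $X$ by: $a\le b$ iff $a=b$, or $a=u$ and $b=\partial w$ for some $u,w\in X$ with $u\,R\,w$; let $\partial$ be the involution that exchanges the two copies. Let $\mu_+(G)$ be the matrix whose algebra consists of the upsets of this poset with $\cap$, $\cup$, the greatest and the least upset, and $\neg U=(X\sqcup\partial X)\setminus\partial[U]$, and whose only designated value is the greatest upset. For a logic $L$ let $\mathcal K_L$ be the class of all non-empty graphs $G$ such that $\mu_+(G)$ is a model of $L$. A homomorphic class of non-empty graphs is a class $\mathcal C$ of non-empty graphs such that $G\in\mathcal C$ and $G\to H$ imply $H\in\mathcal C$; it is generated by $\mathcal S$ if it is the least such class containing $\mathcal S$. Let $n\ge 2$. Then neither $ECQ_n$ nor $ETL_n$ is complete with respect to any finite set of finite matrices. Moreover, $\mathcal K_{ECQ_n}=\mathcal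 K_{ETL_n}$ is the class of all non-empty graphs that are not $n$-colorable, and this class is a homomorphic class that is not generated, as a homomorphic class, by any finite set of graphs. -/

import Mathlib

universe u v w

namespace SuperBelnap

/-! ### Formulas, rules and logics -/

/-- Formulas in the signature `∧, ∨, ⊤, ⊥, ¬` of De Morgan algebras over a set of atoms. -/
inductive Formula (Var : Type v) : Type v where
  | var : Var → Formula Var
  | top : Formula Var
  | bot : Formula Var
  | neg : Formula Var → Formula Var
  | and : Formula Var → Formula Var → Formula Var
  | or : Formula Var → Formula Var → Formula Var

/-- The substitution (endomorphism of the formula algebra) given by a map on atoms. -/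
def Formula.subst {Var : Type v} (σ : Var → Formula Var) : Formula Var → Formula Var
  | .var p => σ p
  | .top => .top
  | .bot => .bot
  | .neg φ => .neg (φ.subst σ)
  | .and φ ψ => .and (φ.subst σ) (ψ.subst σ)
  | .or φ ψ => .or (φ.subst σ) (ψ.subst σ)

/-- A rule `Γ ⊢ φ`: a set of premises and a conclusion. -/
abbrev Rule (Var : Type v) : Type v := Set (Formula Var) × Formula Var

/-- A logic: a reflexive, monotone, structural set of rules closed under cut. -/
@[ext]
structure Logic (Var : Type v) where
  Entails : Set (Formula Var) → Formula Var → Prop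
  refl : ∀ φ, Entails {φ} φ
  mono : ∀ Γ Δ φ, Entails Γ φ → Entails (Γ ∪ Δ) φ
  cut : ∀ Γ Δ φ, (∀ δ ∈ Δ, Entails Γ δ) → Entails Δ φ → Entails Γ φ
  structural : ∀ (σ : Var → Formula Var) (Γ : Set (Formula Var)) (φ : Formula Var),
    Entails Γ φ → Entails (Formula.subst σ '' Γ) (φ.subst σ)

/-- `L.IsExtensionOf B`: each rule valid in `B` also holds in `L`. -/
def Logic.IsExtensionOf {Var : Type v} (L B : Logic Var) : Prop :=
  ∀ Γ φ, B.Entails Γ φ → L.Entails Γ φ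

/-- The extension of `B` by a set of rules `ρ`: the least logic which extends `B` and
validates each rule in `ρ`, i.e. the intersection of all such logics. -/
def Logic.extend {Var : Type v} (B : Logic Var) (ρ : Set (Rule Var)) : Logic Var where
  Entails Γ φ := ∀ L : Logic Var, L.IsExtensionOf B → (∀ r ∈ ρ, L.Entails r.1 r.2) →
    L.Entails Γ φ
  refl φ L _ _ := L.refl φ
  mono Γ Δ φ h L h₁ h₂ := L.mono Γ Δ φ (h L h₁ h₂)
  cut Γ Δ φ h h' L h₁ h₂ := L.cut Γ Δ φ (fun δ hδ => h δ hδ L h₁ h₂) (h' L h₁ h₂)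
  structural σ Γ φ h L h₁ h₂ := L.structural σ Γ φ (h L h₁ h₂)

/-! ### Logical matrices -/

/-- A logical matrix: an (arbitrary) algebra in the signature `∧, ∨, ⊤, ⊥, ¬` together with a set
of designated values. -/
structure LogicalMatrix : Type (u + 1) where
  Carrier : Type u
  top : Carrier
  bot : Carrier
  neg : Carrier → Carrier
  and : Carrier → Carrier → Carrier
  or : Carrier → Carrier → Carrier
  designated : Set Carrier

/-- The valuation (homomorphism from the formula algebra) determined by its values on atoms. -/
def LogicalMatrix.eval (A : LogicalMatrix.{u}) {Var : Type v} (e : Var → A.Carrier) :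
    Formula Var → A.Carrier
  | .var p => e p
  | .top => A.top
  | .bot => A.bot
  | .neg φ => A.neg (A.eval e φ)
  | .and φ ψ => A.and (A.eval e φ) (A.eval e ψ)
  | .or φ ψ => A.or (A.eval e φ) (A.eval e ψ)

/-- The rule `Γ ⊢ φ` is valid in the matrix `A`. -/
def LogicalMatrix.Validates (A : LogicalMatrix.{u}) {Var : Type v}
    (Γ : Set (Formula Var)) (φ : Formula Var) : Prop :=
  ∀ e : Var → A.Carrier, (∀ γ ∈ Γ, A.eval e γ ∈ A.designated) → A.eval e φ ∈ A.designated

theorem LogicalMatrix.eval_subst (A : LogicalMatrix.{u}) {Var : Type v} (e : Var → A.Carrier)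
    (σ : Var → Formula Var) (φ : Formula Var) :
    A.eval e (φ.subst σ) = A.eval (fun p => A.eval e (σ p)) φ := by
  induction φ with
  | var p => rfl
  | top => rfl
  | bot => rfl
  | neg φ ih => simp only [Formula.subst, LogicalMatrix.eval, ih]
  | and φ ψ ih₁ ih₂ => simp only [Formula.subst, LogicalMatrix.eval, ih₁, ih₂]
  | or φ ψ ih₁ ih₂ => simp only [Formula.subst, LogicalMatrix.eval, ih₁, ih₂]

/-- The logic `Log K` determined by a set of matrices `K`. -/
def Logic.ofMatrices (Var : Type v) (K : Set LogicalMatrix.{u}) : Logic Var where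
  Entails Γ φ := ∀ A ∈ K, A.Validates Γ φ
  refl φ A _ e h := h φ rfl
  mono Γ Δ φ h A hA e he := h A hA e fun γ hγ => he γ (Or.inl hγ)
  cut Γ Δ φ h h' A hA e he := h' A hA e fun δ hδ => h δ hδ A hA e he
  structural σ Γ φ h A hA e he := by
    rw [LogicalMatrix.eval_subst]
    refine h A hA _ fun γ hγ => ?_
    rw [← LogicalMatrix.eval_subst]
    exact he _ ⟨γ, hγ, rfl⟩

/-- `L` is complete with respect to the set of matrices `K` if `L = Log K`. -/
def Logic.IsCompleteWrt {Var : Type v} (L : Logic Var) (K : Set LogicalMatrix.{u}) : Prop :=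
  L = Logic.ofMatrices Var K

/-- The matrix `A` is a model of the logic `L`: each rule of `L` is valid in `A`. -/
def LogicalMatrix.IsModel (A : LogicalMatrix.{u}) {Var : Type v} (L : Logic Var) : Prop :=
  ∀ Γ φ, L.Entails Γ φ → A.Validates Γ φ

/-! ### The logics `BD`, `ETL`, `ECQₙ` and `ETLₙ` -/

/-- A matrix over the four-element De Morgan algebra, the diamond whose De Morgan negation fixes
both middle elements. It is presented as `Bool × Bool` with the componentwise lattice structure;
the first component says "at least true" and the second one says "not false". Thus
`(true, true)` is True, `(false, false)` is False, `(true, false)` is Both and `(false, true)` is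
Neither. -/
def dmFour (F : Set (Bool × Bool)) : LogicalMatrix.{0} where
  Carrier := Bool × Bool
  top := (true, true)
  bot := (false, false)
  neg x := (!x.2, !x.1)
  and x y := (x.1 && y.1, x.2 && y.2)
  or x y := (x.1 || y.1, x.2 || y.2)
  designated := F

/-- The matrix of Belnap–Dunn logic: the designated values are True and Both. -/
def matrixBD : LogicalMatrix.{0} := dmFour {x | x.1 = true}

/-- The matrix of the Exactly True Logic: the only designated value is True. -/
def matrixETL : LogicalMatrix.{0} := dmFour {(true, true)}

/-- Belnap–Dunn logic. -/
def BD (Var : Type v) : Logic Var := Logic.ofMatrices Var {matrixBD}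

/-- The Exactly True Logic. -/
def ETL (Var : Type v) : Logic Var := Logic.ofMatrices Var {matrixETL}

/-- The disjunction of a list of formulas (`⊥` if the list is empty). -/
def bigOr {Var : Type v} : List (Formula Var) → Formula Var
  | [] => .bot
  | [φ] => φ
  | φ :: ψ :: l => .or φ (bigOr (ψ :: l))

/-- The formula `(p₁ ∧ ¬p₁) ∨ … ∨ (pₙ ∧ ¬pₙ)`. -/
def chi {Var : Type v} {n : ℕ} (p : Fin n → Var) : Formula Var :=
  bigOr (List.ofFn fun i => .and (.var (p i)) (.neg (.var (p i))))

/-- The explosive rule `(p₁ ∧ ¬p₁) ∨ … ∨ (pₙ ∧ ¬pₙ) ⊢ ∅`, i.e. the rule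
`(p₁ ∧ ¬p₁) ∨ … ∨ (pₙ ∧ ¬pₙ) ⊢ q` where `p₁, …, pₙ, q` are distinct atoms. (All choices of the atoms
yield the same rule up to renaming.) -/
def explosiveRule (Var : Type v) (n : ℕ) : Set (Rule Var) :=
  {r | ∃ (p : Fin n → Var) (q : Var), Function.Injective p ∧ q ∉ Set.range p ∧
    r = ({chi p}, .var q)}

/-- The logic `ECQₙ`. -/
def ECQ (Var : Type v) (n : ℕ) : Logic Var := (BD Var).extend (explosiveRule Var n)

/-- The logic `ETLₙ`. -/
def ETLn (Var : Type v) (n : ℕ) : Logic Var := (ETL Var).extend (explosiveRule Var n)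

/-! ### Graphs -/

/-- A finite (possibly empty) symmetric graph with loops allowed. -/
structure FinGraph : Type (w + 1) where
  V : Type w
  finite : Finite V
  Adj : V → V → Prop
  symm : ∀ a b, Adj a b → Adj b a

/-- There is a graph homomorphism `G → H`. -/
def FinGraph.HomTo (G : FinGraph.{u}) (H : FinGraph.{w}) : Prop := Nonempty (G.Adj →r H.Adj)

/-- The complete graph `Kₙ`: the set `{1, …, n}` with the inequality relation. -/
def completeFinGraph (n : ℕ) : FinGraph.{0} where
  V := Fin n
  finite := inferInstance
  Adj a b := a ≠ b
  symm _ _ h := h.symm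

/-- `G` is `n`-colorable: there is a homomorphism `G → Kₙ`. -/
def FinGraph.NColorable (G : FinGraph.{w}) (n : ℕ) : Prop := G.HomTo (completeFinGraph n)

/-- A homomorphic class of non-empty graphs. -/
def IsHomomorphicClass (C : Set FinGraph.{w}) : Prop :=
  (∀ G ∈ C, Nonempty G.V) ∧ ∀ G ∈ C, ∀ H : FinGraph.{w}, G.HomTo H → H ∈ C

/-- `C` is the homomorphic class generated by `S`: the least homomorphic class of
non-empty graphs which contains `S`. -/
def IsHomomorphicClassGeneratedBy (C S : Set FinGraph.{w}) : Prop :=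
  IsLeast {D : Set FinGraph.{w} | IsHomomorphicClass D ∧ S ⊆ D} C

/-! ### Frames, complex matrices and the matrix of a graph -/

/-- A frame: a poset with an order-inverting involution and an upset of designated points. -/
structure InvFrame : Type (w + 1) where
  P : Type w
  order : PartialOrder P
  inv : P → P
  inv_inv : ∀ a, inv (inv a) = a
  inv_antitone : ∀ a b, a ≤ b → inv b ≤ inv a
  D : Set P
  isUpperSet_D : IsUpperSet D

attribute [instance] InvFrame.order

/-- The complex matrix of a frame: the bounded distributive lattice of upsets, with
`¬U = P \ ∂[U]`, where the designated upsets are those which contain `D`. -/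
def InvFrame.complexMatrix (F : InvFrame.{w}) : LogicalMatrix.{w} where
  Carrier := {U : Set F.P // IsUpperSet U}
  top := ⟨Set.univ, isUpperSet_univ⟩
  bot := ⟨∅, isUpperSet_empty⟩
  neg U := ⟨(F.inv '' U.1)ᶜ, by
    rintro a b hab ha ⟨c, hc, rfl⟩
    refine ha ⟨F.inv a, U.2 ?_ hc, F.inv_inv a⟩
    have := F.inv_antitone _ _ hab
    rwa [F.inv_inv] at this⟩
  and U W := ⟨U.1 ∩ W.1, U.2.inter W.2⟩
  or U W := ⟨U.1 ∪ W.1, U.2.union W.2⟩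
  designated := {U | F.D ⊆ U.1}

/-- The order on `X ⊔ ∂X` for a graph on `X`, where `Sum.inl u` is `u` and `Sum.inr u` is `∂u`:
`a ≤ b` iff `a = b`, or `a = u` and `b = ∂w` for some adjacent `u` and `w`. -/
@[reducible]
def FinGraph.frameOrder (G : FinGraph.{w}) : PartialOrder (G.V ⊕ G.V) where
  le a b := a = b ∨ ∃ x y, a = Sum.inl x ∧ b = Sum.inr y ∧ G.Adj x y
  le_refl a := Or.inl rfl
  le_trans a b c := by
    rintro (rfl | ⟨x, y, rfl, rfl, h⟩) (rfl | ⟨x', y', h₁, rfl, h'⟩)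
    · exact Or.inl rfl
    · exact Or.inr ⟨x', y', h₁, rfl, h'⟩
    · exact Or.inr ⟨x, y, rfl, rfl, h⟩
    · exact absurd h₁ (by simp)
  le_antisymm a b := by
    rintro (rfl | ⟨x, y, rfl, rfl, h⟩) h'
    · rfl
    · rcases h' with h' | ⟨x', y', h₁, _, _⟩
      · exact h'.symm
      · exact absurd h₁ (by simp)

/-- The frame `P₊(G)`: the involutive poset `P(G)` with all points designated. -/
def FinGraph.framePlus (G : FinGraph.{w}) : InvFrame.{w} where
  P := G.V ⊕ G.V
  order := G.frameOrder
  inv := Sum.swap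
  inv_inv := Sum.swap_swap
  inv_antitone := by
    rintro a b (rfl | ⟨x, y, rfl, rfl, h⟩)
    · exact Or.inl rfl
    · exact Or.inr ⟨y, x, rfl, rfl, G.symm _ _ h⟩
  D := Set.univ
  isUpperSet_D := fun _ _ _ _ => trivial

/-- The matrix `μ₊(G)` of a graph `G`: the complex matrix of the frame `P₊(G)`. -/
def FinGraph.muPlus (G : FinGraph.{w}) : LogicalMatrix.{w} := G.framePlus.complexMatrix

/-- The class of all non-empty graphs `G` such that `μ₊(G)` is a model of `L`. -/
def graphClass {Var : Type v} (L : Logic Var) : Set FinGraph.{w} :=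
  {G | Nonempty G.V ∧ G.muPlus.IsModel L}

/-- The class of all non-empty graphs which are not `n`-colorable. -/
def nonColorable (n : ℕ) : Set FinGraph.{w} := {G | Nonempty G.V ∧ ¬ G.NColorable n}

end SuperBelnap

namespace SuperBelnap

/-! ### Frame semantics -/

/-! Truth at a point `x` of a frame depends only on the values of atoms at `x` and at its involute,
and such a pair of points is a valuation in the four-element algebra. Hence every `μ₊(G)` is a model
of BD and of ETL. The premise of the explosive rule is designated in `μ₊(G)` when upsets `U i` are
such that each point lies in some `U i` that omits its involute. Read at the vertices, such a family
is an `n`-coloring, and for `n ≥ 2` each coloring yields such a family. This identifies both graph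
classes (`graphClass_extend`).

The negative results need graphs that are not `n`-colorable but have no short odd closed walk; shift
graphs provide them (`exists_large_odd_girth`). A finite graph or matrix only detects odd closed
walks up to some bound: a symmetric relation on it that has none up to that bound is 2-colorable
(`exists_odd_walk_bound`).

For incompleteness, the graph `G` is encoded in a formula with one atom per vertex whose explosion
fails in `μ₊(G)`, a model of the logic. A valuation in a finite matrix partitions the vertices by
value. Closed walks between classes lift to `G` with the same length, so the graph of classes has no
short odd closed walk and is 2-colorable. A coloring makes the formula with identified atoms entail
an instance of the explosive premise. So the explosion holds in each of the finitely many matrices,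
although the logic does not prove it. -/

/-- Truth of a formula at a point of a set with an involution. -/
def sat {Var : Type v} {X : Type w} (inv : X → X) (V : Var → X → Prop) : X → Formula Var → Prop
  | x, .var p => V p x
  | _, .top => True
  | _, .bot => False
  | x, .neg φ => ¬ sat inv V (inv x) φ
  | x, .and φ ψ => sat inv V x φ ∧ sat inv V x ψ
  | x, .or φ ψ => sat inv V x φ ∨ sat inv V x ψ

theorem sat_map {Var : Type v} {X : Type u} {Y : Type w} {i : X → X} {j : Y → Y} (h : X → Y)
    (hh : ∀ x, h (i x) = j (h x)) (V : Var → Y → Prop) (x : X) (φ : Formula Var) :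
    sat i (fun p x => V p (h x)) x φ ↔ sat j V (h x) φ := by
  induction φ generalizing x with
  | var p => rfl
  | top => rfl
  | bot => rfl
  | neg φ ih => simp only [sat, ih, hh]
  | and φ ψ ih₁ ih₂ => simp only [sat, ih₁, ih₂]
  | or φ ψ ih₁ ih₂ => simp only [sat, ih₁, ih₂]

theorem sat_subst {Var : Type v} {X : Type w} (inv : X → X) (V : Var → X → Prop)
    (σ : Var → Formula Var) (x : X) (φ : Formula Var) :
    sat inv V x (φ.subst σ) ↔ sat inv (fun p y => sat inv V y (σ p)) x φ := by
  induction φ generalizing x with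
  | var p => rfl
  | top => rfl
  | bot => rfl
  | neg φ ih => simp only [Formula.subst, sat, ih]
  | and φ ψ ih₁ ih₂ => simp only [Formula.subst, sat, ih₁, ih₂]
  | or φ ψ ih₁ ih₂ => simp only [Formula.subst, sat, ih₁, ih₂]

/-- The four-element algebra is the algebra of all subsets of the two-point set `Bool` with
involution `not`: the first component is truth at `true`, the second truth at `false`. -/
theorem dmFour_eval_iff {Var : Type v} (F : Set (Bool × Bool)) (e : Var → Bool × Bool)
    (φ : Formula Var) :
    (((dmFour F).eval e φ).1 = true ↔
      sat not (fun p b => (cond b (e p).1 (e p).2) = true) true φ) ∧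
    (((dmFour F).eval e φ).2 = true ↔
      sat not (fun p b => (cond b (e p).1 (e p).2) = true) false φ) := by
  induction φ with
  | var p => exact ⟨Iff.rfl, Iff.rfl⟩
  | top => simp [sat, LogicalMatrix.eval, dmFour]
  | bot => simp [sat, LogicalMatrix.eval, dmFour]
  | neg φ ih =>
    constructor
    · simp only [sat, Bool.not_true, ← ih.2]
      simp [LogicalMatrix.eval, dmFour]
    · simp only [sat, Bool.not_false, ← ih.1]
      simp [LogicalMatrix.eval, dmFour]
  | and φ ψ ih₁ ih₂ =>
    simp only [sat, ← ih₁.1, ← ih₁.2, ← ih₂.1, ← ih₂.2]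
    simp [LogicalMatrix.eval, dmFour]
  | or φ ψ ih₁ ih₂ =>
    simp only [sat, ← ih₁.1, ← ih₁.2, ← ih₂.1, ← ih₂.2]
    simp [LogicalMatrix.eval, dmFour]

/-- A point and its involute determine a valuation in the four-element algebra. -/
theorem dmFour_eval_point {Var : Type v} {X : Type w} (F : Set (Bool × Bool)) (inv : X → X)
    (hinv : ∀ x, inv (inv x) = x) (V : Var → X → Prop) (x : X) :
    ∃ e : Var → Bool × Bool, ∀ φ, (((dmFour F).eval e φ).1 = true ↔ sat inv V x φ) ∧
      (((dmFour F).eval e φ).2 = true ↔ sat inv V (inv x) φ) := by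
  classical
  refine ⟨fun p => (decide (V p x), decide (V p (inv x))), fun φ => ?_⟩
  have key : (fun (p : Var) (b : Bool) => (cond b (decide (V p x)) (decide (V p (inv x)))) = true) =
      fun p b => V p (cond b x (inv x)) := by
    funext p b
    cases b <;> simp
  have h := dmFour_eval_iff F (fun p => (decide (V p x), decide (V p (inv x)))) φ
  simp only [key] at h
  have hm := fun b => sat_map (i := not) (j := inv) (fun b : Bool => cond b x (inv x))
    (fun b => by cases b <;> simp [hinv]) V b φ
  rw [hm, hm] at h
  exact h

theorem BD_sound {Var : Type v} {Γ : Set (Formula Var)} {φ : Formula Var}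
    (h : (BD Var).Entails Γ φ) {X : Type w} (inv : X → X) (hinv : ∀ x, inv (inv x) = x)
    (V : Var → X → Prop) (x : X) (hΓ : ∀ γ ∈ Γ, sat inv V x γ) : sat inv V x φ := by
  obtain ⟨e, he⟩ := dmFour_eval_point {x | x.1 = true} inv hinv V x
  exact (he φ).1.1 (h matrixBD rfl e fun γ hγ => (he γ).1.2 (hΓ γ hγ))

/-- Only True is designated, which requires both components; hence the premises are needed at `x`
and at its involute. This is available in `μ₊(G)` because all points are designated. -/
theorem ETL_sound {Var : Type v} {Γ : Set (Formula Var)} {φ : Formula Var}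
    (h : (ETL Var).Entails Γ φ) {X : Type w} (inv : X → X) (hinv : ∀ x, inv (inv x) = x)
    (V : Var → X → Prop) (x : X) (hΓ : ∀ γ ∈ Γ, sat inv V x γ ∧ sat inv V (inv x) γ) :
    sat inv V x φ := by
  obtain ⟨e, he⟩ := dmFour_eval_point {(true, true)} inv hinv V x
  have := h matrixETL rfl e fun γ hγ =>
    Prod.ext ((he γ).1.2 (hΓ γ hγ).1) ((he γ).2.2 (hΓ γ hγ).2)
  exact (he φ).1.1 (congrArg Prod.fst this)

theorem BD_complete {Var : Type v} {Γ : Set (Formula Var)} {φ : Formula Var}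
    (h : ∀ V : Var → Bool → Prop, (∀ γ ∈ Γ, sat not V true γ) → sat not V true φ) :
    (BD Var).Entails Γ φ := by
  rintro A rfl e he
  exact (dmFour_eval_iff _ e φ).1.2 (h _ fun γ hγ => (dmFour_eval_iff _ e γ).1.1 (he γ hγ))

theorem ETL_isExtensionOf_BD (Var : Type v) : (ETL Var).IsExtensionOf (BD Var) := by
  rintro Γ φ h A rfl e he
  refine Prod.ext ((dmFour_eval_iff _ e φ).1.2 ?_) ((dmFour_eval_iff _ e φ).2.2 ?_)
  · exact BD_sound h not Bool.not_not _ _ fun γ hγ =>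
      (dmFour_eval_iff _ e γ).1.1 (congrArg Prod.fst (he γ hγ))
  · exact BD_sound h not Bool.not_not _ _ fun γ hγ =>
      (dmFour_eval_iff _ e γ).2.1 (congrArg Prod.snd (he γ hγ))

/-- Membership of a point in the value of a formula in the complex matrix of a frame. -/
theorem mem_complexMatrix_eval {Var : Type v} (F : InvFrame.{w})
    (e : Var → {U : Set F.P // IsUpperSet U}) (x : F.P) (φ : Formula Var) :
    x ∈ (F.complexMatrix.eval e φ).1 ↔ sat F.inv (fun p y => y ∈ (e p).1) x φ := by
  induction φ generalizing x with
  | var p => rfl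
  | top => exact iff_of_true (Set.mem_univ x) trivial
  | bot => exact iff_of_false (Set.notMem_empty x) id
  | neg φ ih =>
    simp only [sat, ← ih]
    refine not_congr ⟨?_, fun h => ⟨_, h, F.inv_inv x⟩⟩
    rintro ⟨y, hy, rfl⟩
    rwa [F.inv_inv]
  | and φ ψ ih₁ ih₂ => exact and_congr (ih₁ x) (ih₂ x)
  | or φ ψ ih₁ ih₂ => exact or_congr (ih₁ x) (ih₂ x)

theorem muPlus_eval_mem_designated {Var : Type v} (G : FinGraph.{w})
    (e : Var → G.muPlus.Carrier) (φ : Formula Var) :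
    G.muPlus.eval e φ ∈ G.muPlus.designated ↔
      ∀ x, sat G.framePlus.inv (fun p y => y ∈ (e p).1) x φ :=
  ⟨fun h x => (mem_complexMatrix_eval G.framePlus e x φ).1 (h trivial),
    fun h x _ => (mem_complexMatrix_eval G.framePlus e x φ).2 (h x)⟩

theorem muPlus_isModel_BD (Var : Type v) (G : FinGraph.{w}) : G.muPlus.IsModel (BD Var) := by
  intro Γ φ h e he
  rw [muPlus_eval_mem_designated]
  exact fun x => BD_sound h _ G.framePlus.inv_inv _ x fun γ hγ =>
    (muPlus_eval_mem_designated G e γ).1 (he γ hγ) x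

theorem muPlus_isModel_ETL (Var : Type v) (G : FinGraph.{w}) : G.muPlus.IsModel (ETL Var) := by
  intro Γ φ h e he
  rw [muPlus_eval_mem_designated]
  exact fun x => ETL_sound h _ G.framePlus.inv_inv _ x fun γ hγ =>
    ⟨(muPlus_eval_mem_designated G e γ).1 (he γ hγ) x,
      (muPlus_eval_mem_designated G e γ).1 (he γ hγ) _⟩

/-! ### Finite disjunctions and conjunctions -/

theorem sat_bigOr {Var : Type v} {X : Type w} (inv : X → X) (V : Var → X → Prop) (x : X)
    (l : List (Formula Var)) : sat inv V x (bigOr l) ↔ ∃ φ ∈ l, sat inv V x φ := by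
  induction l with
  | nil => simp [bigOr, sat]
  | cons φ l ih =>
    cases l with
    | nil => simp [bigOr]
    | cons ψ l => simp only [bigOr, sat, ih, List.exists_mem_cons_iff]

/-- The conjunction of a list of formulas (`⊤` if the list is empty). -/
def bigAnd {Var : Type v} : List (Formula Var) → Formula Var
  | [] => .top
  | φ :: l => .and φ (bigAnd l)

theorem sat_bigAnd {Var : Type v} {X : Type w} (inv : X → X) (V : Var → X → Prop) (x : X)
    (l : List (Formula Var)) : sat inv V x (bigAnd l) ↔ ∀ φ ∈ l, sat inv V x φ := by
  induction l with
  | nil => simp [bigAnd, sat]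
  | cons φ l ih => simp only [bigAnd, sat, ih, List.forall_mem_cons]

theorem sat_chi {Var : Type v} {X : Type w} (inv : X → X) (V : Var → X → Prop) (x : X) {n : ℕ}
    (p : Fin n → Var) :
    sat inv V x (chi p) ↔ ∃ i, V (p i) x ∧ ¬ V (p i) (inv x) := by
  simp [chi, sat_bigOr, List.mem_ofFn, sat]

/-! ### Explosive rules in the matrices of graphs -/

theorem exists_explosive_atoms (Var : Type v) [Infinite Var] (n : ℕ) :
    ∃ (p : Fin n → Var) (q : Var), Function.Injective p ∧ q ∉ Set.range p := by
  refine ⟨fun i => Infinite.natEmbedding Var i, Infinite.natEmbedding Var n, ?_, ?_⟩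
  · exact fun i j h => Fin.ext ((Infinite.natEmbedding Var).injective h)
  · rintro ⟨i, hi⟩
    exact i.2.ne ((Infinite.natEmbedding Var).injective hi)

/-- Color `x` by some `i` with `x` in `U i` and `∂x` outside it. If adjacent `x`, `y` shared the
color `i`, then `x ≤ ∂y` would put `∂y` in `U i`. -/
theorem nColorable_of_cover {G : FinGraph.{w}} {n : ℕ} (U : Fin n → Set (G.V ⊕ G.V))
    (hU : ∀ i x y, G.Adj x y → Sum.inl x ∈ U i → Sum.inr y ∈ U i)
    (hcov : ∀ x, ∃ i, Sum.inl x ∈ U i ∧ Sum.inr x ∉ U i) : G.NColorable n := by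
  choose c hc hc' using hcov
  refine ⟨⟨c, fun {a b} hab h => hc' b ?_⟩⟩
  rw [← h]
  exact hU _ _ _ hab (hc a)

theorem muPlus_validates_explosive {Var : Type v} {G : FinGraph.{w}} {n : ℕ}
    (hG : ¬ G.NColorable n) : ∀ r ∈ explosiveRule Var n, G.muPlus.Validates r.1 r.2 := by
  rintro _ ⟨p, q, -, -, rfl⟩ e he
  have h := (muPlus_eval_mem_designated G e _).1 (he _ rfl)
  simp only [sat_chi] at h
  refine absurd (nColorable_of_cover (fun i => (e (p i)).1) (fun i x y hxy hx => ?_)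
    fun x => h (Sum.inl x)) hG
  exact (e (p i)).2 (Or.inr ⟨x, y, rfl, rfl, hxy⟩ : G.frameOrder.le (Sum.inl x) (Sum.inr y)) hx

/-- The upset of the frame of `G` that a homomorphism out of `G` assigns to a target vertex `a`: the
preimage of `a` together with the involutes of the preimages of its neighbors. -/
def homUpset (G : FinGraph.{w}) {H : Type u} (R : H → H → Prop) (f : G.V → H)
    (hf : ∀ x y, G.Adj x y → R (f x) (f y)) (a : H) : G.muPlus.Carrier :=
  ⟨Sum.elim (fun x => f x = a) (fun x => R a (f x)), by
    intro b b' hb h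
    rcases (hb : G.frameOrder.le b b') with rfl | ⟨x, y, rfl, rfl, hxy⟩
    · exact h
    · have hx : f x = a := h
      show R a (f y)
      exact hx ▸ hf x y hxy⟩

theorem not_validates_explosive {Var : Type v} {G : FinGraph.{w}} [Nonempty G.V] {n : ℕ}
    (hn : 2 ≤ n) (hG : G.NColorable n) {p : Fin n → Var} {q : Var} (hp : Function.Injective p)
    (hq : q ∉ Set.range p) : ¬ G.muPlus.Validates {chi p} (.var q) := by
  obtain ⟨c⟩ := hG
  intro h
  let e : Var → G.muPlus.Carrier := Function.extend p
    (homUpset G (fun a b : Fin n => a ≠ b) c fun x y hxy => c.map_rel hxy) fun _ => G.muPlus.bot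
  have hep : ∀ i, e (p i) = homUpset G (fun a b : Fin n => a ≠ b) c
    (fun x y hxy => c.map_rel hxy) i := fun i => hp.extend_apply _ _ i
  have heq : e q = G.muPlus.bot := Function.extend_apply' _ _ _ hq
  have h1 := h e (by
    rintro _ rfl
    rw [muPlus_eval_mem_designated]
    intro x
    rw [sat_chi]
    simp only [hep]
    rcases x with x | x
    · exact ⟨c x, rfl, fun h => h rfl⟩
    -- The point `∂x` lies in the upset of every color other than that of `x`, and `x` does not;
    -- this needs a second color.
    · have : Nontrivial (Fin n) := Fin.nontrivial_iff_two_le.2 hn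
      obtain ⟨i, hi⟩ := exists_ne (α := Fin n) (c x)
      exact ⟨i, hi, fun h => hi (Eq.symm h)⟩)
  rw [muPlus_eval_mem_designated] at h1
  have h2 := h1 (Sum.inl (Classical.arbitrary G.V))
  simp only [sat, heq] at h2
  exact h2

theorem muPlus_isModel_extend {Var : Type v} {G : FinGraph.{w}} {n : ℕ} {B : Logic Var}
    (hB : G.muPlus.IsModel B) (hG : ¬ G.NColorable n) :
    G.muPlus.IsModel (B.extend (explosiveRule Var n)) := by
  intro Γ φ h
  refine h (Logic.ofMatrices Var {G.muPlus}) ?_ ?_ _ rfl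
  · rintro Γ φ h _ rfl
    exact hB Γ φ h
  · rintro r hr _ rfl
    exact muPlus_validates_explosive hG r hr

theorem graphClass_extend {Var : Type v} [Infinite Var] {n : ℕ} (hn : 2 ≤ n) {B : Logic Var}
    (hB : ∀ G : FinGraph.{w}, G.muPlus.IsModel B) :
    graphClass.{v, w} (B.extend (explosiveRule Var n)) = nonColorable.{w} n := by
  ext G
  refine and_congr_right fun hne => ⟨fun h hG => ?_, muPlus_isModel_extend (hB G)⟩
  obtain ⟨p, q, hp, hq⟩ := exists_explosive_atoms Var n
  exact not_validates_explosive hn hG hp hq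
    (h _ _ fun L _ hL => hL _ ⟨p, q, hp, hq, rfl⟩)

theorem isHomomorphicClass_nonColorable (n : ℕ) : IsHomomorphicClass (nonColorable.{w} n) := by
  refine ⟨fun G hG => hG.1, fun G hG H ⟨f⟩ => ⟨hG.1.map f, fun ⟨g⟩ => hG.2 ⟨g.comp f⟩⟩⟩

/-- Injectivity of `p` lets the substitution be prescribed on its atoms, and `q`, being fresh, can
be sent to any conclusion. -/
theorem extend_explosive_subst {Var : Type v} [Infinite Var] (n : ℕ) (B : Logic Var)
    (ψ : Fin n → Formula Var) (φ : Formula Var) :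
    ∃ (p : Fin n → Var) (σ : Var → Formula Var), (∀ i, σ (p i) = ψ i) ∧
      (B.extend (explosiveRule Var n)).Entails {(chi p).subst σ} φ := by
  obtain ⟨p, q, hp, hq⟩ := exists_explosive_atoms Var n
  refine ⟨p, Function.extend p ψ fun _ => φ, hp.extend_apply _ _, ?_⟩
  have h := (B.extend (explosiveRule Var n)).structural (Function.extend p ψ fun _ => φ)
    {chi p} (.var q) fun L _ hL => hL _ ⟨p, q, hp, hq, rfl⟩
  rwa [Set.image_singleton, Formula.subst, Function.extend_apply' _ _ _ hq] at h


/-! ### Odd closed walks -/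

/-- A closed walk of length `m` in the relation `r`. -/
def HasClosedWalk {V : Type w} (r : V → V → Prop) (m : ℕ) : Prop :=
  ∃ f : ℕ → V, (∀ i < m, r (f i) (f (i + 1))) ∧ f m = f 0

theorem HasClosedWalk.map {V : Type u} {W : Type w} {r : V → V → Prop} {s : W → W → Prop}
    {m : ℕ} (h : HasClosedWalk r m) (f : V → W) (hf : ∀ a b, r a b → s (f a) (f b)) :
    HasClosedWalk s m := by
  obtain ⟨g, hg, hg'⟩ := h
  exact ⟨fun i => f (g i), fun i hi => hf _ _ (hg i hi), congrArg f hg'⟩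

theorem exists_two_coloring {V : Type w} (r : V → V → Prop) (hr : ∀ a b, r a b → r b a)
    (h : ∀ m, Odd m → ¬ HasClosedWalk r m) : ∃ c : V → Fin 2, ∀ a b, r a b → c a ≠ c b := by
  have hloop : ∀ a, ¬ r a a := fun a ha => h 1 odd_one ⟨fun _ => a, fun _ _ => ha, rfl⟩
  let G : SimpleGraph V := { Adj := r, symm := ⟨hr⟩, loopless := ⟨hloop⟩ }
  have hG : G.Colorable 2 := by
    rw [SimpleGraph.two_colorable_iff_forall_loop_even]
    intro u w
    by_contra hodd
    rw [Nat.not_even_iff_odd] at hodd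
    exact h _ hodd ⟨w.getVert, fun i hi => w.adj_getVert_succ hi, by simp⟩
  obtain ⟨c⟩ := hG
  exact ⟨c, fun a b hab => c.valid hab⟩

/-- On a finite set there is a bound such that each symmetric relation without odd closed walks
up to the bound is 2-colorable. -/
theorem exists_odd_walk_bound (V : Type w) [Finite V] :
    ∃ M : ℕ, ∀ r : V → V → Prop, (∀ a b, r a b → r b a) →
      (∀ m ≤ M, Odd m → ¬ HasClosedWalk r m) → ∃ c : V → Fin 2, ∀ a b, r a b → c a ≠ c b := by
  classical
  -- For each relation, the length of one odd closed walk serves as the bound. There are finitely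
  -- many relations on `V`, so these bounds have a common upper bound.
  have key : ∀ r : V → V → Prop, ∃ M : ℕ, (∀ m ≤ M, Odd m → ¬ HasClosedWalk r m) →
      ∀ m, Odd m → ¬ HasClosedWalk r m := by
    intro r
    by_cases h : ∃ m, Odd m ∧ HasClosedWalk r m
    · obtain ⟨m, hm, hw⟩ := h
      exact ⟨m, fun h => absurd hw (h m le_rfl hm)⟩
    · push Not at h
      exact ⟨0, fun _ => h⟩
  choose M hM using key
  obtain ⟨b, hb⟩ := (Set.finite_range M).bddAbove
  exact ⟨b, fun r hr h => exists_two_coloring r hr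
    (hM r fun m hm => h m (hm.trans (hb ⟨r, rfl⟩)))⟩

theorem exists_uniform_bound {α : Type u} {S : Set α} (hS : S.Finite) (P : α → ℕ → Prop)
    (hP : ∀ a ∈ S, ∃ M, P a M) (hmono : ∀ a M M', M ≤ M' → P a M → P a M') :
    ∃ M, ∀ a ∈ S, P a M := by
  induction S, hS using Set.Finite.induction_on with
  | empty => exact ⟨0, by simp⟩
  | @insert a s _ _ ih =>
    obtain ⟨M, hM⟩ := ih fun b hb => hP b (Or.inr hb)
    obtain ⟨M', hM'⟩ := hP a (Or.inl rfl)
    refine ⟨max M M', ?_⟩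
    rintro b (rfl | hb)
    · exact hmono _ _ _ (le_max_right _ _) hM'
    · exact hmono _ _ _ (le_max_left _ _) (hM b hb)

/-! ### Shift graphs -/

/-- Induction with the color set replaced by its power set: a shorter tuple is colored by the set of
colors of its extensions by a larger last entry. If `init x` and `tail x` get the same set, then the
color of `x`, an extension of `init x`, is also attained by an extension of `tail x`; appending that
entry to `x` gives the longer tuple. -/
theorem exists_shift_monochromatic (k : ℕ) : ∀ (C : Type) [Finite C], ∃ N : ℕ,
    ∀ c : (Fin (k + 1) → Fin N) → C, ∃ x : Fin (k + 2) → Fin N, StrictMono x ∧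
      c (Fin.init x) = c (Fin.tail x) := by
  induction k with
  | zero =>
    intro C _
    refine ⟨Nat.card C + 1, fun c => ?_⟩
    have := Fintype.ofFinite C
    obtain ⟨a, b, hab, hc⟩ := Fintype.exists_ne_map_eq_of_card_lt
      (fun a : Fin (Nat.card C + 1) => c fun _ => a) (by simp)
    wlog hlt : a < b generalizing a b
    · exact this b a hab.symm hc.symm (lt_of_le_of_ne (not_lt.1 hlt) hab.symm)
    refine ⟨![a, b], ?_, ?_⟩
    · rw [Fin.strictMono_iff_lt_succ]
      intro i
      fin_cases i
      exact hlt
    · convert hc using 2 <;> funext i <;> fin_cases i <;> rfl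
  | succ k ih =>
    intro C _
    obtain ⟨N, hN⟩ := ih (Set C)
    refine ⟨N, fun c => ?_⟩
    obtain ⟨x, hx, hc⟩ := hN fun y =>
      {a | ∃ z, y (Fin.last k) < z ∧ c (Fin.snoc (α := fun _ => Fin N) y z) = a}
    have hmem : c x ∈ {a | ∃ z, Fin.init x (Fin.last k) < z ∧
        c (Fin.snoc (α := fun _ => Fin N) (Fin.init x) z) = a} :=
      ⟨x (Fin.last _), hx (Fin.castSucc_lt_last _), by rw [Fin.snoc_init_self]⟩
    rw [hc] at hmem
    obtain ⟨z, hz, hcz⟩ := hmem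
    refine ⟨Fin.snoc (α := fun _ => Fin N) x z, ?_, ?_⟩
    · rw [Fin.strictMono_iff_lt_succ]
      intro i
      induction i using Fin.lastCases with
      | last =>
        rw [Fin.succ_last, Fin.snoc_last, Fin.snoc_castSucc]
        exact hz
      | cast i =>
        rw [Fin.succ_castSucc, Fin.snoc_castSucc, Fin.snoc_castSucc]
        exact hx Fin.castSucc_lt_succ
    · rw [Fin.init_snoc, ← hcz]
      congr 1
      funext i
      induction i using Fin.lastCases with
      | last => rw [Fin.snoc_last, Fin.tail, Fin.succ_last, Fin.snoc_last]
      | cast i =>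
        rw [Fin.snoc_castSucc, Fin.tail, Fin.tail, Fin.succ_castSucc, Fin.snoc_castSucc]

/-- The vertices of the shift graph: the non-isolated increasing `k + 1`-tuples. -/
abbrev ShiftVertex (k N : ℕ) : Type :=
  {y : Fin (k + 1) → Fin N // ∃ x : Fin (k + 2) → Fin N, StrictMono x ∧
    (y = Fin.init x ∨ y = Fin.tail x)}

/-- The adjacency of the shift graph. -/
def ShiftAdj {k N : ℕ} (y z : ShiftVertex k N) : Prop :=
  ∃ x : Fin (k + 2) → Fin N, StrictMono x ∧
    (y.1 = Fin.init x ∧ z.1 = Fin.tail x ∨ y.1 = Fin.tail x ∧ z.1 = Fin.init x)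

theorem ShiftAdj.symm {k N : ℕ} {y z : ShiftVertex k N} (h : ShiftAdj y z) : ShiftAdj z y := by
  obtain ⟨x, hx, h⟩ := h
  exact ⟨x, hx, h.symm.imp And.symm And.symm⟩

theorem exists_shiftAdj {k N : ℕ} (y : ShiftVertex k N) : ∃ z, ShiftAdj y z := by
  obtain ⟨y, x, hx, rfl | rfl⟩ := y
  · exact ⟨⟨Fin.tail x, x, hx, Or.inr rfl⟩, x, hx, Or.inl ⟨rfl, rfl⟩⟩
  · exact ⟨⟨Fin.init x, x, hx, Or.inl rfl⟩, x, hx, Or.inr ⟨rfl, rfl⟩⟩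

theorem ShiftVertex.injective {k N : ℕ} (y : ShiftVertex k N) : Function.Injective y.1 := by
  obtain ⟨y, x, hx, rfl | rfl⟩ := y
  · exact hx.injective.comp (Fin.castSucc_injective _)
  · exact hx.injective.comp (Fin.succ_injective _)

/-- Along a walk by shifts, the entries away from the boundary are moved by an offset of the
same parity as the length of the walk. -/
theorem exists_shift_offset {α : Type u} (Y : ℕ → ℤ → α) (k : ℤ) (m : ℕ)
    (h : ∀ i < m, (∀ j, 0 ≤ j → j < k → Y (i + 1) j = Y i (j + 1)) ∨
      ∀ j, 0 ≤ j → j < k → Y i j = Y (i + 1) (j + 1)) :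
    ∀ i ≤ m, ∃ p : ℤ, |p| ≤ i ∧ (Odd p ↔ Odd i) ∧
      ∀ j, (i : ℤ) ≤ j → j ≤ k - i → Y i (j - p) = Y 0 j := by
  intro i
  induction i with
  | zero => exact fun _ => ⟨0, by simp, by simp, by simp⟩
  | succ i ih =>
    intro hi
    obtain ⟨p, hp, hodd, hY⟩ := ih (by omega)
    rw [abs_le] at hp
    rcases h i hi with h | h
    · refine ⟨p + 1, ?_, ?_, fun j hj hj' => ?_⟩
      · rw [abs_le]; omega
      · rw [Int.odd_iff, Nat.odd_iff] at hodd ⊢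
        omega
      · push_cast at hj hj'
        rw [h _ (by omega) (by omega), ← hY j (by omega) (by omega)]
        congr 1
        ring
    · refine ⟨p - 1, ?_, ?_, fun j hj hj' => ?_⟩
      · rw [abs_le]; omega
      · rw [Int.odd_iff, Nat.odd_iff] at hodd ⊢
        omega
      · push_cast at hj hj'
        rw [← hY j (by omega) (by omega), h _ (by omega) (by omega)]
        congr 1
        ring

/-- After an odd number `m` of shifts the central entries have moved by an odd offset. On a closed
walk the tuple is unchanged and its entries are distinct, so the offset would be zero. The bound `2
* m ≤ k` keeps the entry at position `m` away from the boundary. -/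
theorem not_hasClosedWalk_shiftAdj {k N m : ℕ} (hm : Odd m) (hk : 2 * m ≤ k) :
    ¬ HasClosedWalk (ShiftAdj (k := k) (N := N)) m := by
  rintro ⟨f, hf, hclosed⟩
  let Y : ℕ → ℤ → Fin N := fun i j => (f i).1 (Fin.ofNat (k + 1) j.toNat)
  have hshift : ∀ (x : Fin (k + 2) → Fin N) (j : ℤ), 0 ≤ j → j < k →
      Fin.tail x (Fin.ofNat (k + 1) j.toNat) = Fin.init x (Fin.ofNat (k + 1) (j + 1).toNat) := by
    intro x j h0 h1
    rw [Fin.tail, Fin.init]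
    congr 1
    ext
    rw [Fin.val_succ, Fin.val_castSucc, Fin.val_ofNat, Fin.val_ofNat,
      Nat.mod_eq_of_lt (by omega), Nat.mod_eq_of_lt (by omega)]
    omega
  obtain ⟨p, hp, hodd, hY⟩ := exists_shift_offset Y k m (fun i hi => by
    obtain ⟨x, -, ⟨h1, h2⟩ | ⟨h1, h2⟩⟩ := hf i hi
    · left
      intro j h0 hj
      simp only [Y, h1, h2, hshift x j h0 hj]
    · right
      intro j h0 hj
      simp only [Y, h1, h2, hshift x j h0 hj]) m le_rfl
  have h := hY m le_rfl (by omega)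
  simp only [Y, hclosed] at h
  rw [abs_le] at hp
  have h' := congrArg Fin.val ((f 0).injective h)
  rw [Fin.val_ofNat, Fin.val_ofNat, Nat.mod_eq_of_lt (by omega), Nat.mod_eq_of_lt (by omega)] at h'
  have hp0 : p = 0 := by omega
  rw [hp0] at hodd
  exact absurd (hodd.2 hm) (by decide)

theorem exists_shift_not_colorable (k n : ℕ) : ∃ N : ℕ,
    ∀ c : ShiftVertex k N → Fin n, ∃ y z, ShiftAdj y z ∧ c y = c z := by
  classical
  obtain ⟨N, hN⟩ := exists_shift_monochromatic k (Option (Fin n))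
  refine ⟨N, fun c => ?_⟩
  -- The color `none` fills in tuples that are not vertices; `init x` and `tail x` are vertices, so
  -- it plays no role for them.
  obtain ⟨x, hx, h⟩ := hN fun y => if hy : _ then some (c ⟨y, hy⟩) else none
  have h1 : ∃ x' : Fin (k + 2) → Fin N, StrictMono x' ∧
    (Fin.init x = Fin.init x' ∨ Fin.init x = Fin.tail x') := ⟨x, hx, Or.inl rfl⟩
  have h2 : ∃ x' : Fin (k + 2) → Fin N, StrictMono x' ∧
    (Fin.tail x = Fin.init x' ∨ Fin.tail x = Fin.tail x') := ⟨x, hx, Or.inr rfl⟩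
  simp only [dif_pos h1, dif_pos h2, Option.some.injEq] at h
  exact ⟨⟨_, h1⟩, ⟨_, h2⟩, ⟨x, hx, Or.inl ⟨rfl, rfl⟩⟩, h⟩

/-- There are finite graphs without isolated vertices which are not `n`-colorable and have no
short odd closed walks. -/
theorem exists_large_odd_girth (n M : ℕ) : ∃ G : FinGraph.{w}, Nonempty G.V ∧
    ¬ G.NColorable n ∧ (∀ x, ∃ y, G.Adj x y) ∧ ∀ m ≤ M, Odd m → ¬ HasClosedWalk G.Adj m := by
  obtain ⟨N, hN⟩ := exists_shift_not_colorable (2 * M) n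
  have hcol : ¬ ∃ c : ShiftVertex (2 * M) N → Fin n, ∀ y z, ShiftAdj y z → c y ≠ c z := by
    rintro ⟨c, hc⟩
    obtain ⟨y, z, hyz, h⟩ := hN c
    exact hc y z hyz h
  refine ⟨⟨ULift.{w} (ShiftVertex (2 * M) N), inferInstance, fun a b => ShiftAdj a.down b.down,
    fun a b h => h.symm⟩, ?_, ?_, fun x => ?_, fun m hm hodd h => ?_⟩
  · by_contra hne
    exact hcol ⟨fun y => (hne ⟨⟨y⟩⟩).elim, fun y => (hne ⟨⟨y⟩⟩).elim⟩
  · rintro ⟨c⟩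
    exact hcol ⟨fun y => c ⟨y⟩, fun y z h => c.map_rel (a := ⟨y⟩) (b := ⟨z⟩) h⟩
  · obtain ⟨z, hz⟩ := exists_shiftAdj x.down
    exact ⟨⟨z⟩, hz⟩
  · exact not_hasClosedWalk_shiftAdj (k := 2 * M) (N := N) hodd (by omega)
      (h.map ULift.down fun _ _ h => h)

theorem not_finitely_generated {n : ℕ} (hn : 2 ≤ n) :
    ¬ ∃ S : Set FinGraph.{w}, S.Finite ∧
      IsHomomorphicClassGeneratedBy (nonColorable.{w} n) S := by
  rintro ⟨S, hS, ⟨-, hsub⟩, hleast⟩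
  obtain ⟨M, hM⟩ := exists_uniform_bound hS
    (fun G M => (∀ m ≤ M, Odd m → ¬ HasClosedWalk G.Adj m) →
      ∃ c : G.V → Fin 2, ∀ a b, G.Adj a b → c a ≠ c b)
    (fun G _ => by
      have := G.finite
      obtain ⟨M, hM⟩ := exists_odd_walk_bound G.V
      exact ⟨M, hM _ G.symm⟩)
    fun G M M' hMM' h h' => h fun m hm => h' m (hm.trans hMM')
  obtain ⟨H, hne, hcol, -, hw⟩ := exists_large_odd_girth.{w} n M
  -- The graphs above a member of `S` form a homomorphic class containing `S`, so minimality gives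
  -- some `G` in `S` that maps to `H`. Then `G` has no short odd closed walk either, and so is
  -- 2-colorable.
  have hD : IsHomomorphicClass {H : FinGraph.{w} | ∃ G ∈ S, G.HomTo H} := by
    constructor
    · rintro H ⟨G, hG, ⟨f⟩⟩
      exact (hsub hG).1.map f
    · rintro H ⟨G, hG, ⟨f⟩⟩ H' ⟨g⟩
      exact ⟨G, hG, ⟨g.comp f⟩⟩
  obtain ⟨G, hG, ⟨f⟩⟩ := hleast ⟨hD, fun G hG => ⟨G, hG, ⟨RelHom.id _⟩⟩⟩
    (show H ∈ nonColorable n from ⟨hne, hcol⟩)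
  obtain ⟨c, hc⟩ := hM G hG fun m hm hodd h => hw m hm hodd (h.map f fun _ _ h => f.map_rel h)
  exact (hsub hG).2 ⟨⟨fun x => Fin.castLE hn (c x),
    fun {a b} hab h => hc a b hab (Fin.castLE_injective hn h)⟩⟩


/-! ### The formula of a graph -/

open Classical in
/-- The formula which says that a point is sent to the vertex `g`: the atom of `g` holds, and the
atoms of the vertices not adjacent to `g` are refuted. -/
noncomputable def vertexFormula {Var : Type v} {V : Type w} (r : V → V → Prop) (l : List V)
    (s : V → Var) (g : V) : Formula Var :=
  .and (.var (s g)) (bigAnd ((l.filter fun g' => ¬ r g g').map fun g' => .neg (.var (s g'))))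

open Classical in
/-- The disjunction of the formulas of the vertices which satisfy `P`. -/
noncomputable def graphFormula {Var : Type v} {V : Type w} (r : V → V → Prop) (l : List V)
    (s : V → Var) (P : V → Prop) : Formula Var :=
  bigOr ((l.filter fun g => P g).map (vertexFormula r l s))

theorem sat_vertexFormula {Var : Type v} {V : Type w} {X : Type u} (inv : X → X)
    (U : Var → X → Prop) (x : X) (r : V → V → Prop) {l : List V} (hl : ∀ g, g ∈ l) (s : V → Var)
    (g : V) : sat inv U x (vertexFormula r l s g) ↔
      U (s g) x ∧ ∀ g', ¬ r g g' → ¬ U (s g') (inv x) := by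
  simp [vertexFormula, sat, sat_bigAnd, hl]

theorem sat_graphFormula {Var : Type v} {V : Type w} {X : Type u} (inv : X → X)
    (U : Var → X → Prop) (x : X) (r : V → V → Prop) {l : List V} (hl : ∀ g, g ∈ l) (s : V → Var)
    (P : V → Prop) : sat inv U x (graphFormula r l s P) ↔
      ∃ g, P g ∧ U (s g) x ∧ ∀ g', ¬ r g g' → ¬ U (s g') (inv x) := by
  simp [graphFormula, sat_bigOr, hl, sat_vertexFormula inv U x r hl]

/-- The value of the formula of a graph depends only on the values of its atoms. -/
theorem eval_graphFormula_congr {Var : Type v} {V : Type w} (A : LogicalMatrix.{u})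
    (e : Var → A.Carrier) (r : V → V → Prop) (l : List V) {s t : V → Var}
    (h : ∀ g, e (s g) = e (t g)) (P : V → Prop) :
    A.eval e (graphFormula r l s P) = A.eval e (graphFormula r l t P) := by
  have hAnd : ∀ l : List V, A.eval e (bigAnd (l.map fun g' => .neg (.var (s g')))) =
      A.eval e (bigAnd (l.map fun g' => .neg (.var (t g')))) := by
    intro l
    induction l with
    | nil => rfl
    | cons g l ih => simp only [List.map_cons, bigAnd, LogicalMatrix.eval, ih, h]
  have hOr : ∀ l' : List V, A.eval e (bigOr (l'.map (vertexFormula r l s))) =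
      A.eval e (bigOr (l'.map (vertexFormula r l t))) := by
    intro l'
    have hv : ∀ g, A.eval e (vertexFormula r l s g) = A.eval e (vertexFormula r l t g) := by
      intro g
      simp only [vertexFormula, LogicalMatrix.eval, h, hAnd]
    induction l' with
    | nil => rfl
    | cons g l' ih =>
      cases l' with
      | nil => exact hv g
      | cons g' l' =>
        simp only [List.map_cons, bigOr, LogicalMatrix.eval, hv] at ih ⊢
        rw [ih]
  exact hOr _

/-- The identity of `G` supplies the valuation: `x` satisfies the formula of the vertex `x`, and
`∂x` that of any neighbor of `x`. This is why isolated vertices are excluded. -/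
theorem not_validates_graphFormula {Var : Type v} (G : FinGraph.{w}) [Nonempty G.V]
    (hG : ∀ x, ∃ y, G.Adj x y) {l : List G.V} (hl : ∀ g, g ∈ l) {s : G.V → Var}
    (hs : Function.Injective s) :
    ¬ G.muPlus.Validates {graphFormula G.Adj l s fun _ => True} .bot := by
  intro h
  let e : Var → G.muPlus.Carrier := Function.extend s
    (homUpset G G.Adj id fun x y hxy => hxy) fun _ => G.muPlus.bot
  have hes : ∀ g, e (s g) = homUpset G G.Adj id (fun x y hxy => hxy) g :=
    fun g => hs.extend_apply _ _ g
  have h1 := h e (by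
    rintro _ rfl
    rw [muPlus_eval_mem_designated]
    intro x
    rw [sat_graphFormula _ _ _ _ hl]
    simp only [hes]
    rcases x with x | x
    · exact ⟨x, trivial, rfl, fun g hg hgx => hg (G.symm _ _ hgx)⟩
    · obtain ⟨y, hy⟩ := hG x
      refine ⟨y, trivial, G.symm _ _ hy, fun g hg hgx => hg ?_⟩
      have hgx : x = g := hgx
      exact hgx ▸ G.symm _ _ hy)
  rw [muPlus_eval_mem_designated] at h1
  exact h1 (Sum.inl (Classical.arbitrary G.V))

/-- The relation between the classes of a partition that survives the identification of the atoms
of the vertices in each class. -/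
def ClassAdj {V : Type w} {A : Type u} (r : V → V → Prop) (π : V → A) (a b : A) : Prop :=
  ∃ g h, π g = a ∧ π h = b ∧ (∀ g', π g' = a → r g' h) ∧ ∀ h', π h' = b → r h' g

/-- In the step from class `i` to class `i + 1`, the witness `h i` is adjacent to every member of
class `i`, in particular to the preceding witness `h (i - 1)`. So the witnesses themselves form a
closed walk, started at `h (m - 1)`. -/
theorem HasClosedWalk.of_classAdj {V : Type w} {A : Type u} {r : V → V → Prop} {π : V → A}
    {m : ℕ} (hm : 0 < m) (h : HasClosedWalk (ClassAdj r π) m) : HasClosedWalk r m := by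
  obtain ⟨f, hf, hclosed⟩ := h
  choose g h hg hh hr _ using hf
  have hclass : ∀ i (hi : i < m), π (if h0 : i = 0 then h (m - 1) (by omega)
      else h (i - 1) (by omega)) = f i := by
    intro i hi
    split_ifs with h0
    · rw [hh, Nat.sub_add_cancel hm, hclosed, h0]
    · rw [hh, Nat.sub_add_cancel (by omega)]
  refine ⟨fun i => if hi : i - 1 < m then (if h0 : i = 0 then h (m - 1) (by omega)
      else h (i - 1) hi) else h 0 hm, fun i hi => ?_, ?_⟩
  · have h1 : i - 1 < m := by omega
    simp only [dif_pos h1, Nat.add_sub_cancel, dif_pos hi, Nat.succ_ne_zero, dif_neg,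
      not_false_eq_true]
    exact hr i hi _ (hclass i hi)
  · have h1 : m - 1 < m := by omega
    simp [h1, hm, hm.ne']

/-- If the graph of classes is colorable, then the formula with identified atoms explodes. -/
theorem BD_graphFormula_chi {Var : Type v} {V : Type w} {A : Type u} {n : ℕ}
    (r : V → V → Prop) (hr : ∀ a b, r a b → r b a) {l : List V} (hl : ∀ g, g ∈ l) (π : V → A) (t : A → Var) (c : A → Fin n)
    (hc : ∀ a b, ClassAdj r π a b → c a ≠ c b) (p : Fin n → Var) (σ : Var → Formula Var)
    (hσ : ∀ i, σ (p i) = graphFormula r l (fun g => t (π g)) fun g => c (π g) = i) :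
    (BD Var).Entails {graphFormula r l (fun g => t (π g)) fun _ => True} ((chi p).subst σ) := by
  apply BD_complete
  intro U hU
  obtain ⟨g, -, hg, hg'⟩ := (sat_graphFormula _ _ _ _ hl _ _).1 (hU _ rfl)
  rw [sat_subst, sat_chi]
  simp only [hσ, sat_graphFormula _ _ _ _ hl]
  refine ⟨c (π g), ⟨g, rfl, hg, hg'⟩, ?_⟩
  -- If a vertex `h` of the same color were chosen at the involute, the refuted atoms at the two
  -- points would force all of the class of `h` to be adjacent to `g`, and all of the class of `g`
  -- to `h`. The two classes would then be adjacent.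
  rintro ⟨h, hcol, hh, hh'⟩
  refine hc (π h) (π g) ⟨h, g, rfl, rfl, fun k hk => ?_, fun k hk => ?_⟩ hcol
  · by_contra hkg
    exact hg' k (fun h => hkg (hr _ _ h)) (by rw [hk]; exact hh)
  · by_contra hkh
    exact hh' k (fun h => hkh (hr _ _ h)) (by rw [hk]; exact hg)

/-- The extension, by an explosive rule, of a logic between Belnap–Dunn logic and the logic of the
matrices of graphs is not complete with respect to a finite set of finite matrices. -/
theorem not_isCompleteWrt_extend {Var : Type v} [Infinite Var] {n : ℕ} (hn : 2 ≤ n)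
    {B : Logic Var} (hBD : B.IsExtensionOf (BD Var))
    (hB : ∀ G : FinGraph.{0}, G.muPlus.IsModel B) (K : Set LogicalMatrix.{u}) (hK : K.Finite)
    (hfin : ∀ A ∈ K, Finite A.Carrier) :
    ¬ (B.extend (explosiveRule Var n)).IsCompleteWrt K := by
  intro hcomplete
  obtain ⟨M, hM⟩ := exists_uniform_bound hK
    (fun A M => ∀ r : A.Carrier → A.Carrier → Prop, (∀ a b, r a b → r b a) →
      (∀ m ≤ M, Odd m → ¬ HasClosedWalk r m) → ∃ c : A.Carrier → Fin 2, ∀ a b, r a b → c a ≠ c b)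
    (fun A hA => by
      have := hfin A hA
      exact exists_odd_walk_bound A.Carrier)
    fun A M M' hMM' h r hr h' => h r hr fun m hm => h' m (hm.trans hMM')
  obtain ⟨G, hne, hcol, hiso, hw⟩ := exists_large_odd_girth.{0} n M
  have := G.finite
  have := Fintype.ofFinite G.V
  let l := (Finset.univ : Finset G.V).toList
  have hl : ∀ g, g ∈ l := by simp [l]
  let s : G.V ↪ Var := (Fintype.equivFin G.V).toEmbedding.trans
    (Fin.valEmbedding.trans (Infinite.natEmbedding Var))
  refine not_validates_graphFormula G hiso hl s.injective
    (muPlus_isModel_extend (n := n) (hB G) hcol _ _ ?_)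
  rw [hcomplete]
  intro A hA e he
  let π : G.V → A.Carrier := fun g => e (s g)
  -- One atom is chosen for each value of `e`. Vertices of equal value then share an atom, and the
  -- value of the formula under `e` is unchanged.
  let t : A.Carrier → Var := Function.invFun e
  have ht : ∀ g, e (t (π g)) = e (s g) := fun g => Function.invFun_eq ⟨s g, rfl⟩
  obtain ⟨c, hc⟩ := hM A hA (ClassAdj G.Adj π)
    (fun a b ⟨g, h, hg, hh, h1, h2⟩ => ⟨h, g, hh, hg, h2, h1⟩)
    fun m hm hodd h => hw m hm hodd (h.of_classAdj hodd.pos)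
  let c' : A.Carrier → Fin n := fun a => Fin.castLE hn (c a)
  -- The `i`-th explosive atom becomes the disjunction of the vertex formulas of color `i`.
  obtain ⟨p, σ, hσ, hexp⟩ := extend_explosive_subst n B
    (fun i => graphFormula G.Adj l (fun g => t (π g)) fun g => c' (π g) = i) .bot
  have hL : (B.extend (explosiveRule Var n)).Entails
      {graphFormula G.Adj l (fun g => t (π g)) fun _ => True} .bot := by
    refine (B.extend (explosiveRule Var n)).cut _ {(chi p).subst σ} _ ?_ hexp
    rintro _ rfl L hL _
    exact hL _ _ (hBD _ _ (BD_graphFormula_chi G.Adj G.symm hl π t c'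
      (fun a b hab h => hc a b hab (Fin.castLE_injective hn h)) p σ hσ))
  rw [hcomplete] at hL
  refine hL A hA e ?_
  rintro _ rfl
  rw [eval_graphFormula_congr A e G.Adj l ht]
  exact he _ rfl

end SuperBelnap

theorem mainTheorem8 {Var : Type v} [Infinite Var] (n : ℕ) (hn : 2 ≤ n) :
    (∀ K : Set SuperBelnap.LogicalMatrix.{u}, K.Finite → (∀ A ∈ K, Finite A.Carrier) →
      ¬ (SuperBelnap.ECQ Var n).IsCompleteWrt K) ∧
    (∀ K : Set SuperBelnap.LogicalMatrix.{u}, K.Finite → (∀ A ∈ K, Finite A.Carrier) →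
      ¬ (SuperBelnap.ETLn Var n).IsCompleteWrt K) ∧
    SuperBelnap.graphClass.{v, w} (SuperBelnap.ECQ Var n) = SuperBelnap.nonColorable.{w} n ∧
    SuperBelnap.graphClass.{v, w} (SuperBelnap.ETLn Var n) = SuperBelnap.nonColorable.{w} n ∧
    SuperBelnap.IsHomomorphicClass (SuperBelnap.nonColorable.{w} n) ∧
    ¬ ∃ S : Set SuperBelnap.FinGraph.{w}, S.Finite ∧
      SuperBelnap.IsHomomorphicClassGeneratedBy (SuperBelnap.nonColorable.{w} n) S := by
  exact ⟨SuperBelnap.not_isCompleteWrt_extend hn (fun _ _ h => h)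
      (SuperBelnap.muPlus_isModel_BD Var),
    SuperBelnap.not_isCompleteWrt_extend hn (SuperBelnap.ETL_isExtensionOf_BD Var)
      (SuperBelnap.muPlus_isModel_ETL Var),
    SuperBelnap.graphClass_extend hn (SuperBelnap.muPlus_isModel_BD Var),
    SuperBelnap.graphClass_extend hn (SuperBelnap.muPlus_isModel_ETL Var),
    SuperBelnap.isHomomorphicClass_nonColorable n,
    SuperBelnap.not_finitely_generated hn⟩
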